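/- Let $m,n,q\ge 0$ be integers, and let $\mathcal E(m,n)$ be the finite set of all families $E=(E_k)_{k\in\{0,1\}^m}$ of permutations of $\{0,1\}^n$. A quantum query to $E$ is an application of the unitary $|k\rangle|x\rangle|y\rangle\mapsto|k\rangle|x\rangle|y\oplus E_k(x)\rangle$ (forward) or $|k\rangle|x\rangle|y\rangle\mapsto|k\rangle|x\rangle|y\oplus E_k^{-1}(x)\rangle$ (inverse); the direction is chosen adaptively by the querying algorithm (possibly in superposition). Between queries the algorithm may apply arbitrary quantum operations to its query registers and a finite-dimensional workspace, with no computational restriction. Let $\mathcal D=(\mathcal D_0,\mathcal D_1)$ be a quantum distinguisher in the following experiment. **Phase 1.** A uniformly random $E\in\mathcal E(m,n)$ is chosen, and $\mathcal D_0$ makes at most $q$ quantum queries to $E$, in either direction. It then measures and outputs (a description of) a probability distribution $D$ on $\{0,1\}^m\times\{0,1\}^n\times\{0,1\}^n$; its remaining quantum state is passed on to $\mathcal D_1$. **Phase 2.** A triple $(k_0,s_0,s_1)$ is sampled from $D$. Let $E^{(0)}=E$, and let $E^{(1)}$ be given by $E^{(1)}_{k}=E_{k}$ for $k\ne k_0$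 and $E^{(1)}_{k_0}=E_{k_0}\circ\mathrm{swap}_{s_0,s_1}$, where $\mathrm{swap}_{s_0,s_1}$ exchanges $s_0$ and $s_1$ and fixes every other point. A uniform bit $b$ is chosen; $\mathcal D_1$ is given $(k_0,s_0,s_1)$, makes any finite number of quantum queries to $E^{(b)}$ in either direction, and outputs a guess $b'\in\{0,1\}$. Let $\varepsilon$ be a real number such that $\max_{(k,s,s')}D(k,s,s')\le\varepsilon$ for every distribution $D$ that $\mathcal D_0$ outputs with positive probability (for instance, the largest of these maxima). Then $$\bigl|\Pr[\mathcal D\text{ outputs }1\mid b=1]-\Pr[\mathcal D\text{ outputs }1\mid b=0]\bigr|\;\le\;4\sqrt{2^n\cdot q\cdot\varepsilon}\,.$$ -/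

import Mathlib

noncomputable section

open scoped Matrix ComplexOrder

namespace QICM

/-- Bit strings of length `n`. -/
abbrev Bits (n : ℕ) : Type := Fin n → Bool

/-- Bitwise exclusive or. -/
def bxor {n : ℕ} (a b : Bits n) : Bits n := fun i => Bool.xor (a i) (b i)

/-- The set of all keyed permutations with key length `m` and block length `n`. An ideal cipher is
a uniformly random element of this finite type. -/
abbrev Cipher (m n : ℕ) : Type := Bits m → Equiv.Perm (Bits n)

/-- A triple `(k₀, s₀, s₁)`. -/
abbrev Triple (m n : ℕ) : Type := Bits m × Bits n × Bits n

/-- The cipher `E⁽ᵇ⁾`: for `b = 0` it is `E`; for `b = 1` the permutation `E_{k₀}` is replaced by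
`E_{k₀} ∘ swap_{s₀,s₁}`, and the other permutations are left alone. -/
def resample {m n : ℕ} (E : Cipher m n) (t : Triple m n) (b : Bool) : Cipher m n :=
  fun k => if b = true ∧ k = t.1 then (Equiv.swap t.2.1 t.2.2).trans (E k) else E k

/-- The mode of an oracle call: forward query, inverse query, or no query. The mode is held in a
quantum register, so that the direction of a query (and whether it is made at all) may be chosen
adaptively, even in superposition. -/
inductive Mode : Type
  | fwd
  | inv
  | idle
  deriving DecidableEq

instance : Fintype Mode :=
  ⟨{Mode.fwd, Mode.inv, Mode.idle}, fun x => by cases x <;> simp⟩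

/-- Computational basis of the query registers: mode, key, input, output. -/
abbrev QReg (m n : ℕ) : Type := Mode × Bits m × Bits n × Bits n

instance (m n : ℕ) : DecidableEq (QReg m n) := inferInstance

/-- Action of an oracle call on basis states: `|k⟩|x⟩|y⟩ ↦ |k⟩|x⟩|y ⊕ E_k(x)⟩` (forward),
`|k⟩|x⟩|y⟩ ↦ |k⟩|x⟩|y ⊕ E_k⁻¹(x)⟩` (inverse), or the identity. -/
def queryMap {m n : ℕ} (E : Cipher m n) : QReg m n → QReg m n
  | (Mode.fwd, k, x, y) => (Mode.fwd, k, x, bxor y (E k x))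
  | (Mode.inv, k, x, y) => (Mode.inv, k, x, bxor y ((E k).symm x))
  | (Mode.idle, k, x, y) => (Mode.idle, k, x, y)

/-- The oracle unitary on the query registers and a workspace with computational basis `W`; it
sends the basis vector `|r⟩|w⟩` to `|queryMap E r⟩|w⟩`. -/
def oracle {m n : ℕ} (W : Type*) [DecidableEq W] (E : Cipher m n) :
    Matrix (QReg m n × W) (QReg m n × W) ℂ :=
  Matrix.of fun i j => if i = (queryMap E j.1, j.2) then 1 else 0

/-- A quantum instrument on the Hilbert space with computational basis `H` and with classical
outcomes in `Z`: an arbitrary quantum operation with measurement, in Kraus form. -/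
structure Instrument (H Z : Type*) [Fintype H] [DecidableEq H] [Fintype Z] where
  num : ℕ
  kraus : Z → Fin num → Matrix H H ℂ
  complete : ∑ z, ∑ i, (kraus z i)ᴴ * kraus z i = 1

/-- The unnormalized state after obtaining outcome `z`; its trace is the probability of `z`. -/
def Instrument.apply {H Z : Type*} [Fintype H] [DecidableEq H] [Fintype Z]
    (I : Instrument H Z) (z : Z) (ρ : Matrix H H ℂ) : Matrix H H ℂ :=
  ∑ i, I.kraus z i * ρ * (I.kraus z i)ᴴ

/-- A quantum channel (completely positive trace preserving map): an instrument with a single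
outcome. -/
abbrev Channel (H : Type*) [Fintype H] [DecidableEq H] : Type _ := Instrument H Unit

/-- Run a sequence of steps, each of which is a channel followed by one application of the oracle
unitary `U`. -/
def runSteps {H : Type*} [Fintype H] [DecidableEq H] (U : Matrix H H ℂ) :
    List (Channel H) → Matrix H H ℂ → Matrix H H ℂ
  | [], ρ => ρ
  | C :: L, ρ => runSteps U L (U * C.apply () ρ * Uᴴ)

/-- A two-phase distinguisher with workspace basis `W`. In the first phase it starts in the state
`init`, makes one oracle call after each channel in `steps₁`, and finally measures a classical value
`z`, by which it declares the distribution `dist z`. In the second phase it knows `z` and the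
sampled triple, keeps its quantum state, makes one oracle call after each channel in `steps₂ z t`,
and finally measures its guess. -/
structure Distinguisher (m n : ℕ) (W Z : Type*) [Fintype W] [DecidableEq W] [Fintype Z] where
  init : Matrix (QReg m n × W) (QReg m n × W) ℂ
  init_posSemidef : init.PosSemidef
  init_trace : init.trace = 1
  steps₁ : List (Channel (QReg m n × W))
  output : Instrument (QReg m n × W) Z
  dist : Z → PMF (Triple m n)
  steps₂ : Z → Triple m n → List (Channel (QReg m n × W))
  guess : Z → Triple m n → Instrument (QReg m n × W) Bool

namespace Distinguisher

variable {m n : ℕ} {W Z : Type*} [Fintype W] [DecidableEq W] [Fintype Z]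

/-- The (unnormalized) state at the end of the first phase, if the cipher is `E` and the measured
value is `z`. -/
def state₁ (𝒟 : Distinguisher m n W Z) (E : Cipher m n) (z : Z) :
    Matrix (QReg m n × W) (QReg m n × W) ℂ :=
  𝒟.output.apply z (runSteps (oracle W E) 𝒟.steps₁ 𝒟.init)

/-- The probability, over a uniform cipher, that the first phase ends with the value `z`. -/
def outputProb (𝒟 : Distinguisher m n W Z) (z : Z) : ℝ :=
  (∑ E : Cipher m n, (𝒟.state₁ E z).trace.re) / Fintype.card (Cipher m n)

/-- The probability that the second phase, started in the (unnormalized) state `ρ` with oracle `E`,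
ends with the guess `1`, jointly with the events that `ρ` accounts for. -/
def accept (𝒟 : Distinguisher m n W Z) (z : Z) (t : Triple m n) (E : Cipher m n)
    (ρ : Matrix (QReg m n × W) (QReg m n × W) ℂ) : ℝ :=
  ((𝒟.guess z t).apply true (runSteps (oracle W E) (𝒟.steps₂ z t) ρ)).trace.re

/-- `Pr[𝒟 outputs 1 | b]`: the cipher `E` is uniform, the first phase has oracle `E` and yields `z`,
the triple `t` is drawn from `dist z`, and the second phase has oracle `E⁽ᵇ⁾`. -/
def prOutputsOne (𝒟 : Distinguisher m n W Z) (b : Bool) : ℝ :=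
  (∑ E : Cipher m n, ∑ z : Z, ∑ t : Triple m n,
    (𝒟.dist z t).toReal * 𝒟.accept z t (resample E t b) (𝒟.state₁ E z)) /
      Fintype.card (Cipher m n)

end Distinguisher

/-- The largest point probability of a distribution on triples. -/
def maxPointProb {m n : ℕ} (D : PMF (Triple m n)) : ℝ :=
  Finset.univ.sup' Finset.univ_nonempty fun t => (D t).toReal

end QICM

end

/-!
The resampled cipher `E⁽¹⁾ = resample E t true` is again uniform, and resampling at `t` twice gives
back `E`. Substituting `E⁽¹⁾` for `E` therefore moves the resampling from the second phase to the
first: the two experiments then differ only in whether the state handed to the second phase was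
prepared with `E` or with `E⁽¹⁾`, while the second phase has oracle `E` in both.

The state is kept in purified form, as `V E * (V E)ᴴ` with the columns of `V E` indexed by the
Kraus histories. The quantity to control is `resampleEnergy V`, the sum of
`‖V E - V E⁽¹⁾‖²` (Frobenius norm) over all ciphers and *all* triples. Channels and the final
measurement preserve it. A query acts in the same way for `E` and `E⁽¹⁾`, except on the basis
states that are `Touched`; a basis state is touched by at most `2 · 2ⁿ` triples, and touched
subspaces are preserved by the query, so contributions of different queries add up in the squared
norm. Each query thus raises the energy by at most `8 · 2ⁿ` per cipher
(`resampleEnergy_oracle_le`). Since the energy sums over all triples with weight one, a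
distribution with point probabilities at most `ε` picks up at most `ε` times it, even if the
distribution depends on the measured value.

Finally, twice the acceptance probability is the trace plus a signed quadratic form of norm at most
one. The trace parts cancel after summing over `E`, and the signed parts differ by at most
`‖V E - V E⁽¹⁾‖ ‖V E + V E⁽¹⁾‖` (`abs_signed_sub_le`). The inequality of arithmetic and geometric
means with a weight `c` turns this into the bound `2 c x + 1 / c` with `x = 2ⁿ q ε`, and `c` close
to `1 / √x` gives `3 √x`.
-/

open scoped Matrix ComplexOrder

namespace QICM

/-! ### Frobenius norms and Kraus families -/

section Frobenius

variable {H K J : Type*} [Fintype H] [Fintype K] [Fintype J]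

/-- The square of the Frobenius norm of a matrix. -/
noncomputable def frobSq (V : Matrix H K ℂ) : ℝ := ∑ i, ∑ k, ‖V i k‖ ^ 2

theorem frobSq_nonneg (V : Matrix H K ℂ) : 0 ≤ frobSq V := by
  unfold frobSq; positivity

theorem trace_mul_conjTranspose_re (V : Matrix H K ℂ) : (V * Vᴴ).trace.re = frobSq V := by
  simp [Matrix.trace, Matrix.mul_apply, frobSq, Complex.mul_conj, Complex.normSq_eq_norm_sq,
    -Complex.ofReal_pow, Complex.ofReal_re]

theorem eq_zero_of_frobSq_eq_zero {V : Matrix H K ℂ} (h : frobSq V = 0) : V = 0 := by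
  ext i k
  unfold frobSq at h
  rw [Finset.sum_eq_zero_iff_of_nonneg fun _ _ => by positivity] at h
  have h1 := h i (Finset.mem_univ _)
  rw [Finset.sum_eq_zero_iff_of_nonneg fun _ _ => by positivity] at h1
  simpa using h1 k (Finset.mem_univ _)

theorem frobSq_add_le (V V' : Matrix H K ℂ) : frobSq (V + V') ≤ 2 * frobSq V + 2 * frobSq V' := by
  simp only [frobSq, Finset.mul_sum, ← Finset.sum_add_distrib]
  refine Finset.sum_le_sum fun i _ => Finset.sum_le_sum fun k _ => ?_
  have h : ‖(V + V') i k‖ ≤ ‖V i k‖ + ‖V' i k‖ := norm_add_le _ _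
  nlinarith [norm_nonneg ((V + V') i k), sq_nonneg (‖V i k‖ - ‖V' i k‖)]

/-- The weighted form of `|‖x‖² - ‖y‖²| ≤ ‖x - y‖ ‖x + y‖`. The free weight `c` makes it
additive, so that it can be summed over branches and outcomes before `c` is optimized. -/
theorem abs_frobSq_sub_le (V V' : Matrix H K ℂ) {c : ℝ} (hc : 0 < c) :
    |frobSq V - frobSq V'| ≤ (c * frobSq (V - V') + c⁻¹ * frobSq (V + V')) / 2 := by
  have key : ∀ x y : ℂ, |‖x‖ ^ 2 - ‖y‖ ^ 2| ≤ (c * ‖x - y‖ ^ 2 + c⁻¹ * ‖x + y‖ ^ 2) / 2 := by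
    intro x y
    have h1 : |‖x‖ ^ 2 - ‖y‖ ^ 2| ≤ ‖x - y‖ * ‖x + y‖ := by
      have : ‖x‖ ^ 2 - ‖y‖ ^ 2 = ((x - y) * (starRingEnd ℂ) (x + y)).re := by
        simp only [← Complex.normSq_eq_norm_sq, Complex.normSq_apply, map_add, Complex.mul_re,
          Complex.sub_re, Complex.add_re, Complex.add_im, Complex.sub_im, Complex.conj_re,
          Complex.conj_im]
        ring
      rw [this]
      refine (Complex.abs_re_le_norm _).trans ?_
      rw [norm_mul, RCLike.norm_conj]
    have h2 : 0 ≤ c * (‖x - y‖ - c⁻¹ * ‖x + y‖) ^ 2 := by positivity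
    have h3 : c * (‖x - y‖ - c⁻¹ * ‖x + y‖) ^ 2
        = c * ‖x - y‖ ^ 2 - 2 * (‖x - y‖ * ‖x + y‖) + c⁻¹ * ‖x + y‖ ^ 2 := by
      field_simp
      ring
    linarith
  simp only [frobSq, ← Finset.sum_sub_distrib]
  rw [Finset.mul_sum, Finset.mul_sum, ← Finset.sum_add_distrib, Finset.sum_div]
  refine (Finset.abs_sum_le_sum_abs _ _).trans (Finset.sum_le_sum fun i _ => ?_)
  rw [Finset.mul_sum, Finset.mul_sum, ← Finset.sum_add_distrib, Finset.sum_div]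
  exact (Finset.abs_sum_le_sum_abs _ _).trans (Finset.sum_le_sum fun k _ => key _ _)

theorem sum_frobSq_mul [DecidableEq H] {G : J → Matrix H H ℂ} (hG : ∑ j, (G j)ᴴ * G j = 1)
    (V : Matrix H K ℂ) : ∑ j, frobSq (G j * V) = frobSq V := by
  have h : ∀ j, frobSq (G j * V) = ((G j)ᴴ * G j * (V * Vᴴ)).trace.re := by
    intro j
    rw [← trace_mul_conjTranspose_re, Matrix.conjTranspose_mul, Matrix.mul_assoc (G j)ᴴ,
      Matrix.trace_mul_comm (G j)ᴴ]
    simp only [Matrix.mul_assoc]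
  simp only [h]
  rw [← Complex.re_sum, ← Matrix.trace_sum, ← Finset.sum_mul, hG, one_mul,
    trace_mul_conjTranspose_re]

/-- All the branches `G j * V` of a purified state side by side: if the columns of `V` are the
pure states of an ensemble with density matrix `V * Vᴴ`, those of `stack G V` are the pure states
of the ensemble obtained by applying the Kraus family `G`. -/
def stack (G : J → Matrix H H ℂ) (V : Matrix H K ℂ) : Matrix H (K × J) ℂ :=
  Matrix.of fun i p => (G p.2 * V) i p.1

theorem frobSq_stack (G : J → Matrix H H ℂ) (V : Matrix H K ℂ) :
    frobSq (stack G V) = ∑ j, frobSq (G j * V) := by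
  simp only [frobSq, stack, Matrix.of_apply, Fintype.sum_prod_type]
  rw [Finset.sum_comm (s := (Finset.univ : Finset J))]
  exact Finset.sum_congr rfl fun i _ => Finset.sum_comm

theorem stack_sub {H K J : Type*} [Fintype H] (G : J → Matrix H H ℂ) (V V' : Matrix H K ℂ) :
    stack G (V - V') = stack G V - stack G V' := by
  ext i p
  simp [stack, Matrix.mul_sub]

theorem stack_mul_conjTranspose (G : J → Matrix H H ℂ) (V : Matrix H K ℂ) :
    stack G V * (stack G V)ᴴ = ∑ j, G j * (V * Vᴴ) * (G j)ᴴ := by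
  have h : ∀ j, G j * (V * Vᴴ) * (G j)ᴴ = (G j * V) * (G j * V)ᴴ := fun j => by
    simp only [Matrix.conjTranspose_mul, Matrix.mul_assoc]
  simp only [h]
  ext a b
  rw [Matrix.sum_apply, Matrix.mul_apply, Fintype.sum_prod_type, Finset.sum_comm]
  rfl

/-- A sequence of channels and unitaries followed by an instrument is again an instrument: its
outcomes have a Kraus form. -/
theorem exists_kraus_runSteps [DecidableEq H] {Z : Type*} [Fintype Z] {U : Matrix H H ℂ}
    (hU : Uᴴ * U = 1) (I : Instrument H Z) (L : List (Channel H)) :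
    ∃ (r : ℕ) (G : Z → Fin r → Matrix H H ℂ), ∑ z, ∑ j, (G z j)ᴴ * G z j = 1 ∧
      ∀ z ρ, I.apply z (runSteps U L ρ) = ∑ j, G z j * ρ * (G z j)ᴴ := by
  induction L with
  | nil => exact ⟨I.num, I.kraus, I.complete, fun z ρ => rfl⟩
  | cons C L ih =>
    obtain ⟨r, G, hG, h⟩ := ih
    refine ⟨r * C.num, fun z p => G z (finProdFinEquiv.symm p).1 * U *
      C.kraus () (finProdFinEquiv.symm p).2, ?_, fun z ρ => ?_⟩
    · have hC : ∑ i, (C.kraus () i)ᴴ * C.kraus () i = 1 := by simpa using C.complete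
      have : ∀ z, (∑ p : Fin (r * C.num), (G z (finProdFinEquiv.symm p).1 * U *
          C.kraus () (finProdFinEquiv.symm p).2)ᴴ * (G z (finProdFinEquiv.symm p).1 * U *
          C.kraus () (finProdFinEquiv.symm p).2)) =
          ∑ i, (C.kraus () i)ᴴ * (Uᴴ * (∑ j, (G z j)ᴴ * G z j) * U) * C.kraus () i := by
        intro z
        rw [finProdFinEquiv.symm.sum_comp (fun p : Fin r × Fin C.num =>
          (G z p.1 * U * C.kraus () p.2)ᴴ * (G z p.1 * U * C.kraus () p.2)),
          Fintype.sum_prod_type, Finset.sum_comm]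
        simp only [Matrix.conjTranspose_mul, Matrix.mul_assoc, Finset.mul_sum, Finset.sum_mul]
      simp only [this]
      rw [Finset.sum_comm]
      simp only [← Finset.mul_sum, ← Finset.sum_mul, hG, mul_one, hU, hC]
    · change I.apply z (runSteps U L (U * C.apply () ρ * Uᴴ)) = _
      rw [h, finProdFinEquiv.symm.sum_comp (fun p : Fin r × Fin C.num =>
          (G z p.1 * U * C.kraus () p.2) * ρ * (G z p.1 * U * C.kraus () p.2)ᴴ),
          Fintype.sum_prod_type]
      simp only [Instrument.apply, Matrix.conjTranspose_mul, Matrix.mul_assoc, Finset.mul_sum,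
        Finset.sum_mul]

/-- For a two-outcome measurement, `2 Pr[true]` is the trace plus a signed sum of squared norms.
The signed part is what limits the distinguishing advantage: passing to it gains the factor two
between the trace norm of a difference of states and its trace distance. -/
theorem abs_signed_sub_le [DecidableEq H] {U : Matrix H H ℂ} (hU : Uᴴ * U = 1)
    (I : Instrument H Bool) (L : List (Channel H)) (V V' : Matrix H K ℂ) {c : ℝ} (hc : 0 < c) :
    |2 * (I.apply true (runSteps U L (V * Vᴴ))).trace.re - frobSq V -
      (2 * (I.apply true (runSteps U L (V' * V'ᴴ))).trace.re - frobSq V')| ≤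
      (c * frobSq (V - V') + c⁻¹ * frobSq (V + V')) / 2 := by
  obtain ⟨r, G, hG, h⟩ := exists_kraus_runSteps hU I L
  have hp : ∀ X : Matrix H K ℂ, (I.apply true (runSteps U L (X * Xᴴ))).trace.re =
      ∑ j, frobSq (G true j * X) := by
    intro X
    rw [h, ← stack_mul_conjTranspose, trace_mul_conjTranspose_re, frobSq_stack]
  have hs : ∀ X : Matrix H K ℂ, frobSq X =
      ∑ j, frobSq (G true j * X) + ∑ j, frobSq (G false j * X) := by
    intro X
    rw [← Fintype.sum_prod_type'] at hG
    rw [← sum_frobSq_mul hG X, Fintype.sum_prod_type, Fintype.sum_bool]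
  have hb : ∀ b, |∑ j, frobSq (G b j * V) - ∑ j, frobSq (G b j * V')| ≤
      (c * ∑ j, frobSq (G b j * (V - V')) + c⁻¹ * ∑ j, frobSq (G b j * (V + V'))) / 2 := by
    intro b
    rw [← Finset.sum_sub_distrib, Finset.mul_sum, Finset.mul_sum, ← Finset.sum_add_distrib,
      Finset.sum_div]
    refine (Finset.abs_sum_le_sum_abs _ _).trans (Finset.sum_le_sum fun j _ => ?_)
    rw [Matrix.mul_sub, Matrix.mul_add]
    exact abs_frobSq_sub_le _ _ hc
  rw [hp, hp, hs V, hs V', hs (V - V'), hs (V + V')]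
  have ht := abs_le.1 (hb true)
  have hf := abs_le.1 (hb false)
  rw [abs_le]
  constructor <;> linarith [ht.1, ht.2, hf.1, hf.2]

end Frobenius

/-! ### Resampling and queries -/

section Query

variable {m n : ℕ}

theorem resample_false (E : Cipher m n) (t : Triple m n) : resample E t false = E := by
  funext k; simp [resample]

theorem resample_resample (t : Triple m n) (E : Cipher m n) :
    resample (resample E t true) t true = E := by
  funext k
  by_cases h : k = t.1
  · ext x : 1
    simp [resample, h]
  · simp [resample, h]

theorem sum_resample {M : Type*} [AddCommMonoid M] (t : Triple m n) (f : Cipher m n → M) :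
    ∑ E, f (resample E t true) = ∑ E, f E :=
  Equiv.sum_comp (Function.Involutive.toPerm (fun E => resample E t true) (resample_resample t)) f

theorem queryMap_queryMap (E : Cipher m n) (r : QReg m n) : queryMap E (queryMap E r) = r := by
  have h : ∀ a b : Bits n, bxor (bxor a b) b = a := fun a b => by
    funext i; simp [bxor]
  obtain ⟨_ | _ | _, k, x, y⟩ := r <;> simp [queryMap, h]

variable {W K : Type*} [Fintype W] [DecidableEq W] [Fintype K]

theorem oracle_mul_apply {K : Type*} (E : Cipher m n) (V : Matrix (QReg m n × W) K ℂ) (i : QReg m n × W)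
    (k : K) : (oracle W E * V) i k = V (queryMap E i.1, i.2) k := by
  have h : ∀ j : QReg m n × W,
      i = (queryMap E j.1, j.2) ↔ j = (queryMap E i.1, i.2) := fun j => by
    constructor <;> rintro rfl <;> simp [queryMap_queryMap]
  simp [Matrix.mul_apply, oracle, h]

theorem oracle_conjTranspose_mul_self (E : Cipher m n) :
    (oracle W E)ᴴ * oracle W E = 1 := by
  have h : (oracle W E)ᴴ = oracle W E := by
    ext i j
    have h : j = (queryMap E i.1, i.2) ↔ i = (queryMap E j.1, j.2) := by
      constructor <;> rintro rfl <;> simp [queryMap_queryMap]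
    simp [oracle, Matrix.conjTranspose_apply, h]
  rw [h]
  ext i j
  rw [oracle_mul_apply]
  simp only [oracle, Matrix.of_apply, Matrix.one_apply]
  refine if_congr ⟨fun h => ?_, fun h => by rw [h]⟩ rfl rfl
  exact Function.Involutive.injective
    (f := fun i : QReg m n × W => (queryMap E i.1, i.2)) (fun i => by simp [queryMap_queryMap]) h

theorem sum_queryMap {W M : Type*} [Fintype W] [AddCommMonoid M] (E : Cipher m n) (f : QReg m n × W → M) :
    ∑ i : QReg m n × W, f (queryMap E i.1, i.2) = ∑ i, f i :=
  Equiv.sum_comp (Function.Involutive.toPerm (fun i : QReg m n × W => (queryMap E i.1, i.2))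
    (fun i => by simp [queryMap_queryMap])) f

/-- The basis states on which a query can tell `E` from its resampling at `t`: the query is made
with the key of `t`, at one of the two swapped points, or in the inverse direction at one of their
images. -/
def Touched (E : Cipher m n) (t : Triple m n) : QReg m n → Prop
  | (Mode.fwd, k, x, _) => k = t.1 ∧ (x = t.2.1 ∨ x = t.2.2)
  | (Mode.inv, k, x, _) => k = t.1 ∧ ((E k).symm x = t.2.1 ∨ (E k).symm x = t.2.2)
  | (Mode.idle, _, _, _) => False

theorem touched_queryMap (E : Cipher m n) (t : Triple m n) (r : QReg m n) :
    Touched E t (queryMap E r) ↔ Touched E t r := by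
  obtain ⟨_ | _ | _, k, x, y⟩ := r <;> simp [queryMap, Touched]

theorem touched_resample (E : Cipher m n) (t : Triple m n) (r : QReg m n) :
    Touched (resample E t true) t r ↔ Touched E t r := by
  obtain ⟨_ | _ | _, k, x, y⟩ := r
  · simp [Touched]
  · simp only [Touched]
    refine and_congr_right fun hk => ?_
    simp only [resample, hk, and_self, if_true, Equiv.symm_trans_apply, Equiv.symm_swap,
      Equiv.swap_apply_eq_iff, Equiv.swap_apply_left, Equiv.swap_apply_right]
    exact or_comm
  · simp [Touched]

theorem queryMap_resample (E : Cipher m n) (t : Triple m n) (r : QReg m n)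
    (h : ¬ Touched E t r) : queryMap (resample E t true) r = queryMap E r := by
  obtain ⟨_ | _ | _, k, x, y⟩ := r
  · by_cases hk : k = t.1
    · simp only [Touched, hk, true_and, not_or] at h
      simp [queryMap, resample, hk, Equiv.swap_apply_of_ne_of_ne h.1 h.2]
    · simp [queryMap, resample, hk]
  · by_cases hk : k = t.1
    · simp only [Touched, hk, true_and, not_or] at h
      simp [queryMap, resample, hk, Equiv.swap_apply_of_ne_of_ne h.1 h.2]
    · simp [queryMap, resample, hk]
  · rfl

open Classical in
theorem sum_touched_le (E : Cipher m n) (r : QReg m n) :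
    ∑ t : Triple m n, (if Touched E t r then (1 : ℝ) else 0) ≤ 2 * 2 ^ n := by
  have key : ∀ (k : Bits m) (x : Bits n), ∑ t : Triple m n,
      (if k = t.1 ∧ (x = t.2.1 ∨ x = t.2.2) then (1 : ℝ) else 0) ≤ 2 * 2 ^ n := by
    intro k x
    calc ∑ t : Triple m n, (if k = t.1 ∧ (x = t.2.1 ∨ x = t.2.2) then (1 : ℝ) else 0)
        ≤ ∑ t : Triple m n, ((if k = t.1 then (if x = t.2.1 then (1 : ℝ) else 0) else 0) +
            if k = t.1 then (if x = t.2.2 then (1 : ℝ) else 0) else 0) := by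
          refine Finset.sum_le_sum fun t _ => ?_
          by_cases h1 : k = t.1
          · by_cases h2 : x = t.2.1
            · simp only [h1, h2, true_and, true_or, if_true]
              split_ifs <;> norm_num
            · simp [h1, h2]
          · simp [h1]
      _ = 2 * 2 ^ n := by
          simp only [Finset.sum_add_distrib, Fintype.sum_prod_type]
          have h1 : ∀ (a : Bits m) (b : Bits n), ∑ _c : Bits n,
              (if k = a then (if x = b then (1 : ℝ) else 0) else 0) =
              if k = a then (if x = b then 2 ^ n else 0) else 0 := by
            intro a b
            split_ifs <;> simp
          simp only [h1, Finset.sum_ite_irrel, Finset.sum_ite_eq, Finset.mem_univ, if_true,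
            Finset.sum_const_zero, Finset.sum_const, Finset.card_univ, Fintype.card_fun,
            Fintype.card_bool, Fintype.card_fin, nsmul_eq_mul]
          push_cast
          ring
  obtain ⟨_ | _ | _, k, x, y⟩ := r
  · refine le_of_eq_of_le (Finset.sum_congr rfl fun t _ => ?_) (key k x)
    simp only [Touched]
    congr
  · refine le_of_eq_of_le (Finset.sum_congr rfl fun t _ => ?_) (key k ((E k).symm x))
    simp only [Touched]
    congr
  · simp [Touched]

open Classical in
/-- One query, for a fixed triple: the squared distance between the branches for `E` and for its
resampling grows only through the rows that the query touches. -/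
theorem frobSq_oracle_sub_le (E : Cipher m n) (t : Triple m n)
    (V V' : Matrix (QReg m n × W) K ℂ) :
    frobSq (oracle W E * V - oracle W (resample E t true) * V') ≤ frobSq (V - V') +
      (2 * ∑ i : QReg m n × W, (if Touched E t i.1 then 1 else 0) * ∑ k, ‖V i k‖ ^ 2 +
      2 * ∑ i : QReg m n × W,
        (if Touched (resample E t true) t i.1 then 1 else 0) * ∑ k, ‖V' i k‖ ^ 2) := by
  -- Reindex the sums on the right by the basis permutations of the two oracles, so that both
  -- sides can be compared row by row.
  rw [frobSq, frobSq, ← sum_queryMap E (fun i => ∑ k, ‖(V - V') i k‖ ^ 2),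
    ← sum_queryMap E (fun i => (if Touched E t i.1 then 1 else 0) * ∑ k, ‖V i k‖ ^ 2),
    ← sum_queryMap (resample E t true)
      (fun i => (if Touched (resample E t true) t i.1 then 1 else 0) * ∑ k, ‖V' i k‖ ^ 2),
    Finset.mul_sum, Finset.mul_sum, ← Finset.sum_add_distrib, ← Finset.sum_add_distrib]
  refine Finset.sum_le_sum fun i _ => ?_
  simp only [touched_queryMap, touched_resample, Matrix.sub_apply, oracle_mul_apply]
  by_cases h : Touched E t i.1
  · simp only [h, if_true, one_mul]
    refine le_add_of_nonneg_of_le (by positivity) ?_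
    rw [Finset.mul_sum, Finset.mul_sum, ← Finset.sum_add_distrib]
    refine Finset.sum_le_sum fun k _ => ?_
    generalize V (queryMap E i.1, i.2) k = x
    generalize V' (queryMap (resample E t true) i.1, i.2) k = y
    have h1 := norm_sub_le x y
    nlinarith [norm_nonneg (x - y), sq_nonneg (‖x‖ - ‖y‖)]
  · simp [h, queryMap_resample E t i.1 h]

/-- The total squared distance, over all triples and ciphers, between the branch of a cipher and
the branch of its resampling. -/
noncomputable def resampleEnergy (V : Cipher m n → Matrix (QReg m n × W) K ℂ) : ℝ :=
  ∑ t : Triple m n, ∑ E : Cipher m n, frobSq (V E - V (resample E t true))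

/-- Each query raises the resampling energy by at most `8 · 2ⁿ` times the total weight, since a
basis state is touched by at most `2 · 2ⁿ` triples. -/
theorem resampleEnergy_oracle_le (V : Cipher m n → Matrix (QReg m n × W) K ℂ) :
    resampleEnergy (fun E => oracle W E * V E) ≤
      resampleEnergy V + 8 * 2 ^ n * ∑ E, frobSq (V E) := by
  classical
  set T : Triple m n → Cipher m n → ℝ := fun t E =>
    ∑ i : QReg m n × W, (if Touched E t i.1 then 1 else 0) * ∑ k, ‖V E i k‖ ^ 2 with hT
  have h1 : resampleEnergy (fun E => oracle W E * V E) ≤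
      resampleEnergy V + 4 * ∑ t, ∑ E, T t E := by
    unfold resampleEnergy
    rw [Finset.mul_sum, ← Finset.sum_add_distrib]
    refine Finset.sum_le_sum fun t _ => ?_
    refine (Finset.sum_le_sum fun E _ =>
      frobSq_oracle_sub_le E t (V E) (V (resample E t true))).trans (le_of_eq ?_)
    rw [Finset.sum_add_distrib, Finset.sum_add_distrib, ← Finset.mul_sum, ← Finset.mul_sum,
      sum_resample t (T t)]
    ring
  have h2 : ∑ t, ∑ E, T t E ≤ 2 * 2 ^ n * ∑ E, frobSq (V E) := by
    rw [Finset.sum_comm, Finset.mul_sum]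
    refine Finset.sum_le_sum fun E _ => ?_
    rw [hT, Finset.sum_comm, frobSq, Finset.mul_sum]
    refine Finset.sum_le_sum fun i _ => ?_
    rw [← Finset.sum_mul]
    exact mul_le_mul_of_nonneg_right (sum_touched_le E i.1) (by positivity)
  linarith

/-- Running the first phase on purified states, simultaneously for all ciphers: a channel only
splits the columns into branches and keeps the resampling energy. -/
theorem exists_purification_runSteps (L : List (Channel (QReg m n × W))) {K : Type}
    [Fintype K] (V : Cipher m n → Matrix (QReg m n × W) K ℂ) (hV : ∀ E, frobSq (V E) = 1) :
    ∃ (K' : Type) (_ : Fintype K') (V' : Cipher m n → Matrix (QReg m n × W) K' ℂ),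
      (∀ E, runSteps (oracle W E) L (V E * (V E)ᴴ) = V' E * (V' E)ᴴ) ∧
      (∀ E, frobSq (V' E) = 1) ∧
      resampleEnergy V' ≤ resampleEnergy V +
        8 * 2 ^ n * L.length * Fintype.card (Cipher m n) := by
  induction L generalizing K V with
  | nil => exact ⟨K, inferInstance, V, fun E => rfl, hV, by simp⟩
  | cons C L ih =>
    have hC : ∑ i, (C.kraus () i)ᴴ * C.kraus () i = 1 := by simpa using C.complete
    have hS : ∀ X : Matrix (QReg m n × W) K ℂ, frobSq (stack (C.kraus ()) X) = frobSq X :=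
      fun X => by rw [frobSq_stack, sum_frobSq_mul hC]
    have hO : ∀ E, frobSq (oracle W E * stack (C.kraus ()) (V E)) = 1 := fun E => by
      have := sum_frobSq_mul (J := Unit) (G := fun _ => oracle W E)
        (by simpa using oracle_conjTranspose_mul_self (W := W) E) (stack (C.kraus ()) (V E))
      rw [← hV E, ← hS, ← this]
      simp
    obtain ⟨K', i', V', h1, h2, h3⟩ := ih (fun E => oracle W E * stack (C.kraus ()) (V E)) hO
    refine ⟨K', i', V', fun E => ?_, h2, h3.trans ?_⟩
    · rw [← h1 E, runSteps, Instrument.apply, ← stack_mul_conjTranspose]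
      simp only [Matrix.conjTranspose_mul, Matrix.mul_assoc]
    · have h4 := resampleEnergy_oracle_le fun E => stack (C.kraus ()) (V E)
      have h5 : resampleEnergy (fun E => stack (C.kraus ()) (V E)) = resampleEnergy V := by
        simp only [resampleEnergy, ← stack_sub, hS]
      rw [h5] at h4
      simp only [hS, hV, Finset.sum_const, Finset.card_univ, nsmul_eq_mul, mul_one] at h4
      rw [List.length_cons]
      push_cast
      linarith

end Query

/-! ### The distinguishing advantage -/

namespace Distinguisher

variable {m n : ℕ} {W Z : Type*} [Fintype W] [DecidableEq W] [Fintype Z]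

/-- The states at the end of the first phase in purified form. -/
theorem exists_purification_state₁ (𝒟 : Distinguisher m n W Z) :
    ∃ (K : Z → Type) (_ : ∀ z, Fintype (K z))
      (V : ∀ z, Cipher m n → Matrix (QReg m n × W) (K z) ℂ),
      (∀ z E, 𝒟.state₁ E z = V z E * (V z E)ᴴ) ∧ (∀ E, ∑ z, frobSq (V z E) = 1) ∧
      ∑ z, resampleEnergy (V z) ≤
        8 * 2 ^ n * 𝒟.steps₁.length * Fintype.card (Cipher m n) := by
  obtain ⟨r, v, hv⟩ := Matrix.posSemidef_iff_eq_sum_vecMulVec.1 𝒟.init_posSemidef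
  set B : Matrix (QReg m n × W) (Fin r) ℂ := Matrix.of fun a i => v i a with hBdef
  have hB : 𝒟.init = B * Bᴴ := by
    rw [hv]
    ext a b
    simp [hBdef, Matrix.sum_apply, Matrix.mul_apply, Matrix.vecMulVec_apply]
  have hB1 : frobSq B = 1 := by
    rw [← trace_mul_conjTranspose_re, ← hB, 𝒟.init_trace,
      Complex.one_re]
  obtain ⟨K, _, V, h1, h2, h3⟩ := exists_purification_runSteps 𝒟.steps₁ (fun _ => B)
    (fun _ => hB1)
  have h0 : resampleEnergy (fun _ : Cipher m n => B) = 0 := by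
    simp [resampleEnergy, frobSq]
  rw [← hB] at h1
  have hI : ∀ X : Matrix (QReg m n × W) K ℂ,
      ∑ z, frobSq (stack (𝒟.output.kraus z) X) = frobSq X := by
    intro X
    have hc := 𝒟.output.complete
    rw [← Fintype.sum_prod_type'] at hc
    rw [← sum_frobSq_mul hc, Fintype.sum_prod_type]
    simp only [frobSq_stack]
  refine ⟨fun _ => K × Fin 𝒟.output.num, fun _ => inferInstance,
    fun z E => stack (𝒟.output.kraus z) (V E), fun z E => ?_, fun E => ?_, ?_⟩
  · rw [state₁, h1, Instrument.apply, stack_mul_conjTranspose]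
  · rw [hI, h2]
  · rw [h0, zero_add] at h3
    refine le_of_eq_of_le ?_ h3
    simp only [resampleEnergy, ← stack_sub]
    rw [Finset.sum_comm]
    refine Finset.sum_congr rfl fun t _ => ?_
    rw [Finset.sum_comm]
    exact Finset.sum_congr rfl fun E _ => hI _

/-- For a fixed outcome and triple, the substitution `E ↦ E⁽¹⁾` moves the resampling from the
second phase to the first, where it is seen only through the distance of the purified states. -/
theorem abs_sum_accept_sub_le (𝒟 : Distinguisher m n W Z) (z : Z) (t : Triple m n)
    {K : Type*} [Fintype K] (V : Cipher m n → Matrix (QReg m n × W) K ℂ)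
    (hV : ∀ E, 𝒟.state₁ E z = V E * (V E)ᴴ) {c : ℝ} (hc : 0 < c) :
    |∑ E, 𝒟.accept z t (resample E t true) (𝒟.state₁ E z) -
      ∑ E, 𝒟.accept z t (resample E t false) (𝒟.state₁ E z)| ≤
      (c * ∑ E, frobSq (V E - V (resample E t true)) + c⁻¹ * (4 * ∑ E, frobSq (V E))) / 4 := by
  rw [← sum_resample t fun E => 𝒟.accept z t (resample E t true) (𝒟.state₁ E z), abs_sub_comm]
  simp only [resample_resample, resample_false, hV]
  have htr : ∑ E, frobSq (V (resample E t true)) = ∑ E, frobSq (V E) :=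
    sum_resample t fun E => frobSq (V E)
  have hadd : ∑ E, frobSq (V E + V (resample E t true)) ≤ 4 * ∑ E, frobSq (V E) := by
    refine (Finset.sum_le_sum fun E _ => frobSq_add_le _ _).trans (le_of_eq ?_)
    rw [Finset.sum_add_distrib, ← Finset.mul_sum, ← Finset.mul_sum, htr]
    ring
  -- The trace parts of the two sums agree, so only the signed parts differ.
  have hsum : 2 * (∑ E, 𝒟.accept z t E (V E * (V E)ᴴ) -
      ∑ E, 𝒟.accept z t E (V (resample E t true) * (V (resample E t true))ᴴ)) =
      ∑ E, (2 * 𝒟.accept z t E (V E * (V E)ᴴ) - frobSq (V E) -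
        (2 * 𝒟.accept z t E (V (resample E t true) * (V (resample E t true))ᴴ) -
          frobSq (V (resample E t true)))) := by
    simp only [Finset.sum_sub_distrib, ← Finset.mul_sum, htr]
    ring
  have hle : |∑ E, (2 * 𝒟.accept z t E (V E * (V E)ᴴ) - frobSq (V E) -
        (2 * 𝒟.accept z t E (V (resample E t true) * (V (resample E t true))ᴴ) -
          frobSq (V (resample E t true))))| ≤
      (c * ∑ E, frobSq (V E - V (resample E t true)) +
        c⁻¹ * ∑ E, frobSq (V E + V (resample E t true))) / 2 := by
    rw [Finset.mul_sum, Finset.mul_sum, ← Finset.sum_add_distrib, Finset.sum_div]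
    exact (Finset.abs_sum_le_sum_abs _ _).trans (Finset.sum_le_sum fun E _ =>
      abs_signed_sub_le (oracle_conjTranspose_mul_self E) _ _ _ _ hc)
  rw [← hsum, abs_mul, abs_two] at hle
  have := mul_le_mul_of_nonneg_left hadd (inv_pos.2 hc).le
  linarith

/-- The advantage bound with the free weight `c` of the arithmetic-geometric mean inequality. -/
theorem abs_prOutputsOne_sub_le (𝒟 : Distinguisher m n W Z) {q : ℕ} (hq : 𝒟.steps₁.length ≤ q)
    {ε : ℝ} (hε0 : 0 ≤ ε) (hε : ∀ z, 0 < 𝒟.outputProb z → maxPointProb (𝒟.dist z) ≤ ε)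
    {c : ℝ} (hc : 0 < c) :
    |𝒟.prOutputsOne true - 𝒟.prOutputsOne false| ≤ 2 * c * (2 ^ n * q * ε) + c⁻¹ := by
  obtain ⟨K, _, V, h1, h2, h3⟩ := 𝒟.exists_purification_state₁
  set N : ℝ := (Fintype.card (Cipher m n) : ℝ) with hN
  have hN0 : 0 < N := by
    rw [hN]
    exact_mod_cast Fintype.card_pos
  have hpr : ∀ b, 𝒟.prOutputsOne b = (∑ z, ∑ t, (𝒟.dist z t).toReal *
      ∑ E, 𝒟.accept z t (resample E t b) (𝒟.state₁ E z)) / N := by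
    intro b
    rw [prOutputsOne, Finset.sum_comm]
    congr 1
    refine Finset.sum_congr rfl fun z _ => ?_
    rw [Finset.sum_comm]
    exact Finset.sum_congr rfl fun t _ => (Finset.mul_sum _ _ _).symm
  have hdist : ∀ z, ∑ t, (𝒟.dist z t).toReal = 1 := by
    intro z
    have h := (𝒟.dist z).tsum_coe
    rw [tsum_fintype] at h
    rw [← ENNReal.toReal_sum fun t _ => (𝒟.dist z).apply_ne_top t, h, ENNReal.toReal_one]
  -- If `z` has probability zero, then all its branches vanish and nothing is assumed on `dist z`.
  have hw : ∀ z t, (𝒟.dist z t).toReal * ∑ E, frobSq (V z E - V z (resample E t true)) ≤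
      ε * ∑ E, frobSq (V z E - V z (resample E t true)) := by
    intro z t
    rcases (Finset.sum_nonneg fun E (_ : E ∈ Finset.univ) => frobSq_nonneg (V z E)).eq_or_lt
      with h | h
    · have hz : ∀ E, V z E = 0 := fun E => eq_zero_of_frobSq_eq_zero
        ((Finset.sum_eq_zero_iff_of_nonneg fun E _ => frobSq_nonneg (V z E)).1 h.symm E
          (Finset.mem_univ E))
      simp [hz, frobSq]
    · have hout : 0 < 𝒟.outputProb z := by
        rw [outputProb]
        simp only [h1, trace_mul_conjTranspose_re]
        exact div_pos h hN0
      refine mul_le_mul_of_nonneg_right (le_trans ?_ (hε z hout))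
        (Finset.sum_nonneg fun E _ => frobSq_nonneg _)
      exact Finset.le_sup' (fun t => (𝒟.dist z t).toReal) (Finset.mem_univ t)
  have hW : ∑ z, ∑ E, frobSq (V z E) = N := by
    rw [Finset.sum_comm]
    simp [h2, hN]
  have hmain : |(∑ z, ∑ t, (𝒟.dist z t).toReal *
        ∑ E, 𝒟.accept z t (resample E t true) (𝒟.state₁ E z)) -
      ∑ z, ∑ t, (𝒟.dist z t).toReal *
        ∑ E, 𝒟.accept z t (resample E t false) (𝒟.state₁ E z)| ≤
      ∑ z, (c * (ε * resampleEnergy (V z)) / 4 + c⁻¹ * ∑ E, frobSq (V z E)) := by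
    rw [← Finset.sum_sub_distrib]
    refine (Finset.abs_sum_le_sum_abs _ _).trans (Finset.sum_le_sum fun z _ => ?_)
    have hr : c * (ε * resampleEnergy (V z)) / 4 + c⁻¹ * ∑ E, frobSq (V z E) =
        ∑ t, (c * (ε * ∑ E, frobSq (V z E - V z (resample E t true))) / 4 +
          (𝒟.dist z t).toReal * (c⁻¹ * ∑ E, frobSq (V z E))) := by
      rw [Finset.sum_add_distrib, ← Finset.sum_mul, hdist, one_mul, ← Finset.sum_div,
        ← Finset.mul_sum, ← Finset.mul_sum, resampleEnergy]
    rw [hr, ← Finset.sum_sub_distrib]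
    refine (Finset.abs_sum_le_sum_abs _ _).trans (Finset.sum_le_sum fun t _ => ?_)
    rw [← mul_sub, abs_mul, abs_of_nonneg ENNReal.toReal_nonneg]
    refine (mul_le_mul_of_nonneg_left (𝒟.abs_sum_accept_sub_le z t (V z) (h1 z) hc)
      ENNReal.toReal_nonneg).trans ?_
    have := mul_le_mul_of_nonneg_left (hw z t) hc.le
    linarith
  rw [Finset.sum_add_distrib, ← Finset.mul_sum, hW, ← Finset.sum_div, ← Finset.mul_sum,
    ← Finset.mul_sum] at hmain
  rw [hpr, hpr, ← sub_div, abs_div, abs_of_pos hN0, div_le_iff₀ hN0]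
  refine hmain.trans ?_
  have hq' : 8 * 2 ^ n * (𝒟.steps₁.length : ℝ) * N ≤ 8 * 2 ^ n * q * N := by
    gcongr
  have := mul_le_mul_of_nonneg_left (h3.trans hq') (mul_nonneg hc.le hε0)
  linarith

end Distinguisher

end QICM

theorem mainTheorem2 (m n q : ℕ) {W Z : Type*} [Fintype W] [DecidableEq W] [Fintype Z]
    (𝒟 : QICM.Distinguisher m n W Z) (hq : 𝒟.steps₁.length ≤ q)
    (ε : ℝ) (hε : ∀ z : Z, 0 < 𝒟.outputProb z → QICM.maxPointProb (𝒟.dist z) ≤ ε) :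
    |𝒟.prOutputsOne true - 𝒟.prOutputsOne false| ≤ 4 * Real.sqrt (2 ^ n * (q : ℝ) * ε) := by
  -- Some outcome has positive probability, which forces `0 ≤ ε`.
  have hε0 : 0 ≤ ε := by
    obtain ⟨K, _, V, h1, h2, -⟩ := 𝒟.exists_purification_state₁
    obtain ⟨z, -, hz⟩ := Finset.exists_lt_of_sum_lt (s := Finset.univ) (f := fun _ : Z => (0 : ℝ))
      (g := fun z => QICM.frobSq (V z 1)) (by simp [h2])
    have hout : 0 < 𝒟.outputProb z := by
      rw [QICM.Distinguisher.outputProb]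
      simp only [h1, QICM.trace_mul_conjTranspose_re]
      refine div_pos (Finset.sum_pos' (fun E _ => QICM.frobSq_nonneg _)
        ⟨1, Finset.mem_univ _, hz⟩) ?_
      exact_mod_cast Fintype.card_pos
    refine le_trans ?_ (hε z hout)
    exact ENNReal.toReal_nonneg.trans
      (Finset.le_sup' (fun t => (𝒟.dist z t).toReal) (Finset.mem_univ default))
  set x : ℝ := 2 ^ n * (q : ℝ) * ε with hx
  have hx0 : 0 ≤ x := by positivity
  have hs := Real.sq_sqrt hx0
  have hs0 := Real.sqrt_nonneg x
  refine le_of_forall_pos_le_add fun δ hδ => ?_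
  -- The weight `1 / (√x + δ)` stays finite when there are no queries.
  have hc : 0 < (Real.sqrt x + δ)⁻¹ := by positivity
  refine (𝒟.abs_prOutputsOne_sub_le hq hε0 hε hc).trans ?_
  rw [← hx, inv_inv]
  have h : (Real.sqrt x + δ)⁻¹ * x ≤ Real.sqrt x := by
    rw [inv_mul_le_iff₀ (by positivity)]
    nlinarith
  linarith
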